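/- Let $n\ge 0$ and let $0\to H_n\xrightarrow{\delta_n}H_{n-1}\to\cdots\to H_1\xrightarrow{\delta_1}H_0\to 0$ be a finite sequence of (real or complex) Hilbert spaces and bounded linear operators, extended by $H_p=0$ and $\delta_p=0$ for $p<0$ and $p\ge n+1$ (and $\delta_0=0$). Write $N(\cdot)$ and $R(\cdot)$ for the null space and the range. The sequence $(H,\delta)$ is called a Fredholm chain if for every $p=0,\dots,n$ the spaces $$N(\delta_p)/(N(\delta_p)\cap R(\delta_{p+1}))\quad\text{and}\quad R(\delta_{p+1})/(N(\delta_p)\cap R(\delta_{p+1}))$$ are finite dimensional, and its index is then $$\operatorname{ind}(H,\delta)=\sum_{p=0}^n(-1)^p\Big(\dim N(\delta_p)/(N(\delta_p)\cap R(\delta_{p+1}))-\dim R(\delta_{p+1})/(N(\delta_p)\cap R(\delta_{p+1}))\Big).$$ Theorem 6.5. Let $(H,\delta)$ be a Fredholm chain. Then there is an $\epsilon>0$ such that for every sequence of bounded linear operators $\delta'_p\colon H_p\to H_{p-1}$, $p\in\mathbb Z$, on the same Hilbert spaces for which $R(\delta'_p\delta'_{p+1})$ is finite dimensional and $\|\delta_p-\delta'_p\|<\epsilon$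 for all $p\in\mathbb Z$, the sequence $(H,\delta')$ is a Fredholm chain and $$\operatorname{ind}(H,\delta)=\operatorname{ind}(H,\delta').$$ -/

import Mathlib

/-!
A finite sequence `0 → H_n → H_{n-1} → ⋯ → H_1 → H_0 → 0` of Hilbert spaces and bounded operators
`δ_p : H_p → H_{p-1}` is encoded by a family `H : ℕ → Type*` that vanishes above `n`, and by
operators `δ p : H (p + 1) →L[𝕜] H p`; so the Lean term `δ p` is the mathematical `δ_{p+1}`.
The remaining operator `δ_0 : H_0 → 0` is zero, with kernel all of `H_0`.
-/

namespace HilbertChain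

variable {𝕜 : Type*} [RCLike 𝕜] {H : ℕ → Type*} [∀ p, NormedAddCommGroup (H p)]
  [∀ p, InnerProductSpace 𝕜 (H p)]

/-- The null space `N(δ_p) ⊆ H_p`. -/
def nullSpace (δ : ∀ p, H (p + 1) →L[𝕜] H p) : ∀ p, Submodule 𝕜 (H p)
  | 0 => ⊤
  | p + 1 => LinearMap.ker (δ p : H (p + 1) →ₗ[𝕜] H p)

/-- The range `R(δ_{p+1}) ⊆ H_p`. -/
def rangeSpace (δ : ∀ p, H (p + 1) →L[𝕜] H p) (p : ℕ) : Submodule 𝕜 (H p) :=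
  LinearMap.range (δ p : H (p + 1) →ₗ[𝕜] H p)

/-- The quotient space `N(δ_p) / (N(δ_p) ∩ R(δ_{p+1}))`. -/
abbrev NullQuot (δ : ∀ p, H (p + 1) →L[𝕜] H p) (p : ℕ) : Type _ :=
  nullSpace δ p ⧸ (nullSpace δ p ⊓ rangeSpace δ p).submoduleOf (nullSpace δ p)

/-- The quotient space `R(δ_{p+1}) / (N(δ_p) ∩ R(δ_{p+1}))`. -/
abbrev RangeQuot (δ : ∀ p, H (p + 1) →L[𝕜] H p) (p : ℕ) : Type _ :=
  rangeSpace δ p ⧸ (nullSpace δ p ⊓ rangeSpace δ p).submoduleOf (rangeSpace δ p)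

/-- `(H, δ)` is a Fredholm chain `0 → H_n → ⋯ → H_0 → 0`. -/
structure IsFredholmChain (n : ℕ) (δ : ∀ p, H (p + 1) →L[𝕜] H p) : Prop where
  /-- `H_p = 0` for `p ≥ n + 1`. -/
  subsingleton : ∀ p, n < p → Subsingleton (H p)
  finite_nullQuot : ∀ p ≤ n, FiniteDimensional 𝕜 (NullQuot δ p)
  finite_rangeQuot : ∀ p ≤ n, FiniteDimensional 𝕜 (RangeQuot δ p)

/-- The index `∑_{p=0}^n (-1)^p (dim N(δ_p)/(N(δ_p) ∩ R(δ_{p+1})) -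
dim R(δ_{p+1})/(N(δ_p) ∩ R(δ_{p+1})))` of a Fredholm chain. -/
noncomputable def index (n : ℕ) (δ : ∀ p, H (p + 1) →L[𝕜] H p) : ℤ :=
  ∑ p ∈ Finset.range (n + 1), (-1 : ℤ) ^ p *
    ((Module.finrank 𝕜 (NullQuot δ p) : ℤ) - (Module.finrank 𝕜 (RangeQuot δ p) : ℤ))

end HilbertChain

/-! Let π_p be the orthogonal projection onto N(δ_p), kept fixed while δ is perturbed, and compress
δ'_{p+1} to s_p : ker π_{p+1} → N(δ_p). For δ' = δ this is Fredholm: δ_{p+1} maps ker π_{p+1}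
bijectively onto R(δ_{p+1}), which is commensurable with N(δ_p). Fredholm indices are locally
constant (`FiniteDefect.exists_stable`), so s_p stays Fredholm with the same index for δ' near δ.

Conversely, `isFredholmChain_and_index_eq` recovers the chain from its compressions by linear
algebra alone. Finite rank of δ'_p δ'_{p+1} makes the range quotients finite. With i_p the index of
π_p on N(δ'_p), the p-th difference of dimensions is i_p + i_{p+1} - ind s_p. In the alternating sum
the i_p telescope away, leaving -∑ (-1)^p ind s_p. -/

namespace HilbertChain

/-! ### Algebraic Fredholm maps and their index. -/

section Algebra

variable {k : Type*} [Field k] {U V W : Type*} [AddCommGroup U] [Module k U]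
  [AddCommGroup V] [Module k V] [AddCommGroup W] [Module k W]

/-- A linear map whose kernel and cokernel are finite dimensional. -/
structure FiniteDefect (f : V →ₗ[k] W) : Prop where
  finite_ker : FiniteDimensional k (LinearMap.ker f)
  finite_coker : FiniteDimensional k (W ⧸ LinearMap.range f)

/-- The index `dim ker f - dim coker f`. -/
noncomputable def defectIndex (f : V →ₗ[k] W) : ℤ :=
  (Module.finrank k (LinearMap.ker f) : ℤ) - Module.finrank k (W ⧸ LinearMap.range f)

theorem finiteDimensional_of_ker_of_range (f : V →ₗ[k] W)
    (hk : FiniteDimensional k (LinearMap.ker f)) (hr : FiniteDimensional k (LinearMap.range f)) :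
    FiniteDimensional k V := by
  have : FiniteDimensional k (V ⧸ LinearMap.ker f) :=
    Module.Finite.equiv f.quotKerEquivRange.symm
  exact Module.Finite.of_submodule_quotient (LinearMap.ker f)

theorem finiteDimensional_of_le {p q : Submodule k V} (h : p ≤ q) (hq : FiniteDimensional k q) :
    FiniteDimensional k p :=
  Submodule.finiteDimensional_of_le h

theorem finiteDimensional_quotient_of_le {p q : Submodule k V} (h : p ≤ q)
    (hp : FiniteDimensional k (V ⧸ p)) : FiniteDimensional k (V ⧸ q) :=
  Module.Finite.of_surjective (Submodule.factor h) (Submodule.factor_surjective h)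

section Comp

variable (g : V →ₗ[k] W) (f : U →ₗ[k] V)

theorem range_domRestrict_ker_comp :
    LinearMap.range (f.domRestrict (LinearMap.ker (g ∘ₗ f))) =
      LinearMap.ker g ⊓ LinearMap.range f := by
  ext y
  constructor
  · rintro ⟨⟨x, hx⟩, rfl⟩
    exact ⟨hx, x, rfl⟩
  · rintro ⟨hy, x, rfl⟩
    exact ⟨⟨x, hy⟩, rfl⟩

/-- The kernel of `f`, seen inside the kernel of `g ∘ f`. -/
noncomputable def kerDomRestrictKerCompEquiv :
    LinearMap.ker (f.domRestrict (LinearMap.ker (g ∘ₗ f))) ≃ₗ[k] LinearMap.ker f :=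
  (LinearEquiv.ofEq _ _ (by ext; simp)).trans
    (Submodule.comapSubtypeEquivOfLe (LinearMap.ker_le_ker_comp f g))

/-- The map `coker f → coker (g ∘ f)` induced by `g`. -/
noncomputable def cokerMap :
    (V ⧸ LinearMap.range f) →ₗ[k] (W ⧸ LinearMap.range (g ∘ₗ f)) :=
  Submodule.mapQ _ _ g (by rintro _ ⟨x, rfl⟩; exact ⟨x, rfl⟩)

/-- The connecting map `ker g → coker f`. -/
noncomputable def kerToCoker : LinearMap.ker g →ₗ[k] (V ⧸ LinearMap.range f) :=
  (LinearMap.range f).mkQ.domRestrict (LinearMap.ker g)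

/-- Exactness at coker f of 0 → ker f → ker gf → ker g → coker f → coker gf → coker g → 0, the
source of the composition rules below. -/
theorem range_kerToCoker : LinearMap.range (kerToCoker g f) = LinearMap.ker (cokerMap g f) := by
  ext y
  obtain ⟨y, rfl⟩ := Submodule.mkQ_surjective _ y
  constructor
  · rintro ⟨⟨x, hx⟩, h⟩
    rw [← h]
    simpa [kerToCoker, cokerMap] using ⟨0, by simpa using hx.symm⟩
  · intro h
    have h' : ∃ x, g (f x) = g y := by simpa [cokerMap] using h
    obtain ⟨x, hx⟩ := h'
    refine ⟨⟨y - f x, by simp [hx]⟩, ?_⟩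
    simp [kerToCoker]

/-- The kernel of the connecting map is `ker g ∩ range f`. -/
noncomputable def kerKerToCokerEquiv :
    LinearMap.ker (kerToCoker g f) ≃ₗ[k] ↥(LinearMap.ker g ⊓ LinearMap.range f) :=
  (Submodule.equivMapOfInjective _ (LinearMap.ker g).injective_subtype _).trans
    (LinearEquiv.ofEq _ _ (by
      rw [← Submodule.map_comap_subtype]
      congr 1
      ext; simp [kerToCoker]))

/-- The cokernel of `coker f → coker (g ∘ f)` is the cokernel of `g`. -/
noncomputable def cokerCokerMapEquiv :
    ((W ⧸ LinearMap.range (g ∘ₗ f)) ⧸ LinearMap.range (cokerMap g f)) ≃ₗ[k]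
      (W ⧸ LinearMap.range g) :=
  (Submodule.quotEquivOfEq _ _ (by rw [cokerMap, Submodule.range_mapQ])).trans
    (Submodule.quotientQuotientEquivQuotient _ _ (LinearMap.range_comp_le_range f g))

variable {g f}

theorem FiniteDefect.comp (hg : FiniteDefect g) (hf : FiniteDefect f) :
    FiniteDefect (g ∘ₗ f) := by
  have := hg.finite_ker; have := hg.finite_coker
  have := hf.finite_ker; have := hf.finite_coker
  constructor
  · refine finiteDimensional_of_ker_of_range (f.domRestrict (LinearMap.ker (g ∘ₗ f)))
      (Module.Finite.equiv (kerDomRestrictKerCompEquiv g f).symm) ?_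
    rw [range_domRestrict_ker_comp]
    exact finiteDimensional_of_le inf_le_left hg.finite_ker
  · have : FiniteDimensional k
        ((W ⧸ LinearMap.range (g ∘ₗ f)) ⧸ LinearMap.range (cokerMap g f)) :=
      Module.Finite.equiv (cokerCokerMapEquiv g f).symm
    exact Module.Finite.of_submodule_quotient (LinearMap.range (cokerMap g f))

theorem FiniteDefect.left_of_comp (hf : FiniteDefect f) (h : FiniteDefect (g ∘ₗ f)) :
    FiniteDefect g := by
  have := hf.finite_ker; have := hf.finite_coker
  have := h.finite_ker; have := h.finite_coker
  constructor
  · refine finiteDimensional_of_ker_of_range (kerToCoker g f) ?_ inferInstance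
    have : FiniteDimensional k ↥(LinearMap.ker g ⊓ LinearMap.range f) := by
      rw [← range_domRestrict_ker_comp]; infer_instance
    exact Module.Finite.equiv (kerKerToCokerEquiv g f).symm
  · exact Module.Finite.equiv (cokerCokerMapEquiv g f)

theorem FiniteDefect.right_of_comp (hg : FiniteDefect g) (h : FiniteDefect (g ∘ₗ f)) :
    FiniteDefect f := by
  have := hg.finite_ker; have := hg.finite_coker
  have := h.finite_ker; have := h.finite_coker
  constructor
  · exact finiteDimensional_of_le (LinearMap.ker_le_ker_comp f g) h.finite_ker
  · refine finiteDimensional_of_ker_of_range (cokerMap g f) ?_ inferInstance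
    rw [← range_kerToCoker]
    infer_instance

/-- Dimensions along the six-term sequence have alternating sum zero. -/
theorem defectIndex_comp (hg : FiniteDefect g) (hf : FiniteDefect f) :
    defectIndex (g ∘ₗ f) = defectIndex g + defectIndex f := by
  have := hg.finite_ker; have := hg.finite_coker
  have := hf.finite_ker; have := hf.finite_coker
  have := (hg.comp hf).finite_ker; have := (hg.comp hf).finite_coker
  have h₁ := LinearMap.finrank_range_add_finrank_ker (f.domRestrict (LinearMap.ker (g ∘ₗ f)))
  rw [range_domRestrict_ker_comp, (kerDomRestrictKerCompEquiv g f).finrank_eq] at h₁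
  have h₂ := LinearMap.finrank_range_add_finrank_ker (kerToCoker g f)
  rw [range_kerToCoker, (kerKerToCokerEquiv g f).finrank_eq] at h₂
  have h₃ := LinearMap.finrank_range_add_finrank_ker (cokerMap g f)
  have h₄ := Submodule.finrank_quotient_add_finrank (LinearMap.range (cokerMap g f))
  rw [(cokerCokerMapEquiv g f).finrank_eq] at h₄
  unfold defectIndex
  lia

end Comp

theorem FiniteDefect.of_bijective {f : V →ₗ[k] W} (hf : Function.Bijective f) :
    FiniteDefect f := by
  constructor
  · rw [LinearMap.ker_eq_bot.2 hf.1]; infer_instance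
  · rw [LinearMap.range_eq_top.2 hf.2]; infer_instance

theorem defectIndex_of_bijective {f : V →ₗ[k] W} (hf : Function.Bijective f) :
    defectIndex f = 0 := by
  rw [defectIndex, LinearMap.ker_eq_bot.2 hf.1, LinearMap.range_eq_top.2 hf.2]
  have : Subsingleton (W ⧸ (⊤ : Submodule k W)) := Submodule.Quotient.subsingleton_iff.2 rfl
  simp [Module.finrank_zero_of_subsingleton]

theorem FiniteDefect.inclusion {p q : Submodule k V} (h : p ≤ q)
    (hfin : FiniteDimensional k (q ⧸ p.submoduleOf q)) :
    FiniteDefect (Submodule.inclusion h) := by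
  constructor
  · rw [Submodule.ker_inclusion]; infer_instance
  · rw [Submodule.range_inclusion]; exact hfin

theorem defectIndex_inclusion {p q : Submodule k V} (h : p ≤ q) :
    defectIndex (Submodule.inclusion h) = - Module.finrank k (q ⧸ p.submoduleOf q) := by
  rw [defectIndex, Submodule.ker_inclusion, Submodule.range_inclusion]
  simp [Submodule.submoduleOf]
  rfl

/-- The index of the bordered map `(x, c) ↦ (f x + j c, P x)` determines that of `f`. -/
theorem FiniteDefect.of_bordered_bijective {C E : Type*} [AddCommGroup C] [Module k C]
    [AddCommGroup E] [Module k E] [FiniteDimensional k C] [FiniteDimensional k E]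
    {f : V →ₗ[k] W} {j : C →ₗ[k] W} {P : V →ₗ[k] E}
    (h : Function.Bijective ((f.coprod j).prod (P ∘ₗ LinearMap.fst k V C))) :
    FiniteDefect f ∧
      defectIndex f = (Module.finrank k E : ℤ) - Module.finrank k C := by
  set T := (f.coprod j).prod (P ∘ₗ LinearMap.fst k V C)
  have hinl : FiniteDefect (LinearMap.inl k V C) ∧
      defectIndex (LinearMap.inl k V C) = -(Module.finrank k C : ℤ) := by
    have hk : LinearMap.ker (LinearMap.inl k V C) = ⊥ := LinearMap.ker_eq_bot.2 LinearMap.inl_injective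
    have e : ((V × C) ⧸ LinearMap.range (LinearMap.inl k V C)) ≃ₗ[k] C :=
      (Submodule.quotEquivOfEq _ _ (LinearMap.range_inl k V C)).trans
        ((LinearMap.snd k V C).quotKerEquivOfSurjective LinearMap.snd_surjective)
    refine ⟨⟨by rw [hk]; infer_instance, Module.Finite.equiv e.symm⟩, ?_⟩
    rw [defectIndex, hk, e.finrank_eq]; simp
  have hfst : FiniteDefect (LinearMap.fst k W E) ∧
      defectIndex (LinearMap.fst k W E) = (Module.finrank k E : ℤ) := by
    have hr : LinearMap.range (LinearMap.fst k W E) = ⊤ := LinearMap.range_eq_top.2 LinearMap.fst_surjective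
    have e : LinearMap.ker (LinearMap.fst k W E) ≃ₗ[k] E :=
      (LinearEquiv.ofEq _ _ (LinearMap.ker_fst k W E)).trans
        (LinearEquiv.ofInjective _ LinearMap.inr_injective).symm
    refine ⟨⟨Module.Finite.equiv e.symm, by rw [hr]; infer_instance⟩, ?_⟩
    have : Subsingleton (W ⧸ (⊤ : Submodule k W)) :=
      Submodule.Quotient.subsingleton_iff.2 rfl
    rw [defectIndex, hr, e.finrank_eq]
    simp [Module.finrank_zero_of_subsingleton]
  have hT := FiniteDefect.of_bijective h
  -- The three factors have indices dim E, 0 and -dim C.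
  have hf : f = LinearMap.fst k W E ∘ₗ (T ∘ₗ LinearMap.inl k V C) := by
    ext x; simp [T]
  have h₁ := hT.comp hinl.1
  refine ⟨hf ▸ hfst.1.comp h₁, ?_⟩
  rw [hf, defectIndex_comp hfst.1 h₁, defectIndex_comp hT hinl.1, hfst.2, hinl.2,
    defectIndex_of_bijective h]
  ring

end Algebra

/-! ### Exchanging two surjections; compressions of one map. -/

section Algebra

variable {k : Type*} [Field k] {V W A B : Type*} [AddCommGroup V] [Module k V]
  [AddCommGroup W] [Module k W] [AddCommGroup A] [Module k A] [AddCommGroup B] [Module k B]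

/-- The cokernel of `u` restricted to `ker v` is `V / (ker u + ker v)`. -/
noncomputable def cokerDomRestrictKerEquiv (u : V →ₗ[k] A) (v : V →ₗ[k] B)
    (hu : Function.Surjective u) :
    (A ⧸ LinearMap.range (u.domRestrict (LinearMap.ker v))) ≃ₗ[k]
      (V ⧸ LinearMap.ker v ⊔ LinearMap.ker u) :=
  ((Submodule.quotEquivOfEq _ _ (by
      rw [LinearMap.ker_comp, Submodule.ker_mkQ, LinearMap.range_domRestrict,
        Submodule.comap_map_eq])).trans
    (((LinearMap.range (u.domRestrict (LinearMap.ker v))).mkQ ∘ₗ u).quotKerEquivOfSurjective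
      ((Submodule.mkQ_surjective _).comp hu))).symm

/-- The kernel of `u` restricted to `ker v` is `ker v ∩ ker u`. -/
noncomputable def kerDomRestrictKerEquiv (u : V →ₗ[k] A) (v : V →ₗ[k] B) :
    LinearMap.ker (u.domRestrict (LinearMap.ker v)) ≃ₗ[k]
      ↥(LinearMap.ker v ⊓ LinearMap.ker u) :=
  (Submodule.equivMapOfInjective _ (LinearMap.ker v).injective_subtype _).trans
    (LinearEquiv.ofEq _ _ (by
      rw [← Submodule.map_comap_subtype]
      congr 1))

/-- Two surjections restricted to each other's kernel have isomorphic kernels. -/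
noncomputable def kerDomRestrictKerSwap (u : V →ₗ[k] A) (v : V →ₗ[k] B) :
    LinearMap.ker (u.domRestrict (LinearMap.ker v)) ≃ₗ[k]
      LinearMap.ker (v.domRestrict (LinearMap.ker u)) :=
  ((kerDomRestrictKerEquiv u v).trans (LinearEquiv.ofEq _ _ (inf_comm _ _))).trans
    (kerDomRestrictKerEquiv v u).symm

/-- Two surjections restricted to each other's kernel have isomorphic cokernels. -/
noncomputable def cokerDomRestrictKerSwap (u : V →ₗ[k] A) (v : V →ₗ[k] B)
    (hu : Function.Surjective u) (hv : Function.Surjective v) :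
    (A ⧸ LinearMap.range (u.domRestrict (LinearMap.ker v))) ≃ₗ[k]
      (B ⧸ LinearMap.range (v.domRestrict (LinearMap.ker u))) :=
  ((cokerDomRestrictKerEquiv u v hu).trans (Submodule.quotEquivOfEq _ _ (sup_comm _ _))).trans
    (cokerDomRestrictKerEquiv v u hv).symm

theorem FiniteDefect.domRestrict_ker_swap {u : V →ₗ[k] A} {v : V →ₗ[k] B}
    (hu : Function.Surjective u) (hv : Function.Surjective v)
    (h : FiniteDefect (u.domRestrict (LinearMap.ker v))) :
    FiniteDefect (v.domRestrict (LinearMap.ker u)) := by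
  have := h.finite_ker; have := h.finite_coker
  exact ⟨Module.Finite.equiv (kerDomRestrictKerSwap u v),
    Module.Finite.equiv (cokerDomRestrictKerSwap u v hu hv)⟩

theorem defectIndex_domRestrict_ker_swap {u : V →ₗ[k] A} {v : V →ₗ[k] B}
    (hu : Function.Surjective u) (hv : Function.Surjective v) :
    defectIndex (u.domRestrict (LinearMap.ker v)) =
      defectIndex (v.domRestrict (LinearMap.ker u)) := by
  rw [defectIndex, defectIndex, (kerDomRestrictKerSwap u v).finrank_eq,
    (cokerDomRestrictKerSwap u v hu hv).finrank_eq]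

section Step

variable {d : V →ₗ[k] W} {N : Submodule k W} {K : Submodule k V} {π : W →ₗ[k] B}

theorem comp_subtype_eq_domRestrict_comp (d : V →ₗ[k] W) (K : Submodule k V) (π : W →ₗ[k] B) :
    π ∘ₗ d ∘ₗ K.subtype =
      π.domRestrict (LinearMap.range d) ∘ₗ d.rangeRestrict.domRestrict K := rfl

/-- Both sides are π on N ∩ R, which lets the defect of π pass between R and N. -/
theorem domRestrict_comp_inclusion (N R : Submodule k W) (π : W →ₗ[k] B) :
    π.domRestrict R ∘ₗ Submodule.inclusion (inf_le_right : N ⊓ R ≤ R) =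
      π.domRestrict N ∘ₗ Submodule.inclusion (inf_le_left : N ⊓ R ≤ N) := rfl

/-- The compression `K → W → B` of `d` has finite defect if `N` and the range of `d` are
commensurable and both `K → range d` and `π` restricted to `N` have finite defect. -/
theorem FiniteDefect.comp_subtype
    (hN : FiniteDimensional k (N ⧸ (N ⊓ LinearMap.range d).submoduleOf N))
    (hR : FiniteDimensional k
      (LinearMap.range d ⧸ (N ⊓ LinearMap.range d).submoduleOf (LinearMap.range d)))
    (hπ : FiniteDefect (π.domRestrict N)) (hK : FiniteDefect (d.rangeRestrict.domRestrict K)) :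
    FiniteDefect (π ∘ₗ d ∘ₗ K.subtype) := by
  rw [comp_subtype_eq_domRestrict_comp]
  refine FiniteDefect.comp ?_ hK
  refine FiniteDefect.left_of_comp (FiniteDefect.inclusion inf_le_right hR) ?_
  rw [domRestrict_comp_inclusion]
  exact hπ.comp (FiniteDefect.inclusion inf_le_left hN)

theorem finiteDimensional_ker_of_compression (hs : FiniteDefect (π ∘ₗ d ∘ₗ K.subtype)) :
    FiniteDimensional k (LinearMap.ker (d.rangeRestrict.domRestrict K)) := by
  refine finiteDimensional_of_le ?_ hs.finite_ker
  rw [comp_subtype_eq_domRestrict_comp]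
  exact LinearMap.ker_le_ker_comp _ _

/-- π(range d) contains the range of the compression, so has finite codimension; so does π(N ∩ range
d), which lies in π(N). -/
theorem finiteDimensional_coker_of_compression (hs : FiniteDefect (π ∘ₗ d ∘ₗ K.subtype))
    (hR : FiniteDimensional k
      (LinearMap.range d ⧸ (N ⊓ LinearMap.range d).submoduleOf (LinearMap.range d))) :
    FiniteDimensional k (B ⧸ LinearMap.range (π.domRestrict N)) := by
  have h₁ : FiniteDimensional k (B ⧸ LinearMap.range (π.domRestrict (LinearMap.range d))) := by
    refine finiteDimensional_quotient_of_le ?_ hs.finite_coker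
    rw [comp_subtype_eq_domRestrict_comp]
    exact LinearMap.range_comp_le_range _ _
  let i := Submodule.inclusion (inf_le_right : N ⊓ LinearMap.range d ≤ LinearMap.range d)
  have hi : FiniteDefect i := FiniteDefect.inclusion inf_le_right hR
  have := hi.finite_coker
  have : FiniteDimensional k
      (B ⧸ LinearMap.range (π.domRestrict (LinearMap.range d) ∘ₗ i)) := by
    have : FiniteDimensional k (_ ⧸ LinearMap.range (cokerMap (π.domRestrict (LinearMap.range d)) i)) :=
      Module.Finite.equiv (cokerCokerMapEquiv (π.domRestrict (LinearMap.range d)) i).symm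
    exact Module.Finite.of_submodule_quotient
      (LinearMap.range (cokerMap (π.domRestrict (LinearMap.range d)) i))
  refine finiteDimensional_quotient_of_le ?_ this
  rw [domRestrict_comp_inclusion]
  exact LinearMap.range_comp_le_range _ _

theorem finiteDimensional_and_index_of_compression (hs : FiniteDefect (π ∘ₗ d ∘ₗ K.subtype))
    (hR : FiniteDimensional k
      (LinearMap.range d ⧸ (N ⊓ LinearMap.range d).submoduleOf (LinearMap.range d)))
    (hπ : FiniteDefect (π.domRestrict N)) (hK : FiniteDefect (d.rangeRestrict.domRestrict K)) :
    FiniteDimensional k (N ⧸ (N ⊓ LinearMap.range d).submoduleOf N) ∧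
      (Module.finrank k (N ⧸ (N ⊓ LinearMap.range d).submoduleOf N) : ℤ) -
        Module.finrank k
          (LinearMap.range d ⧸ (N ⊓ LinearMap.range d).submoduleOf (LinearMap.range d)) =
      defectIndex (π.domRestrict N) + defectIndex (d.rangeRestrict.domRestrict K) -
        defectIndex (π ∘ₗ d ∘ₗ K.subtype) := by
  have hi := FiniteDefect.inclusion inf_le_right hR
  rw [comp_subtype_eq_domRestrict_comp] at hs ⊢
  have hπR := hK.left_of_comp hs
  have hQ := hπR.comp hi
  rw [domRestrict_comp_inclusion] at hQ
  -- Cancelling π on N leaves the inclusion N ∩ range d → N, whose cokernel is the wanted quotient.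
  have hj := hπ.right_of_comp hQ
  refine ⟨?_, ?_⟩
  · have := hj.finite_coker
    rwa [Submodule.range_inclusion] at this
  · have e₁ := defectIndex_comp hπR hi
    have e₂ := defectIndex_comp hπ hj
    rw [domRestrict_comp_inclusion] at e₁
    rw [defectIndex_inclusion] at e₁ e₂
    rw [defectIndex_comp hπR hK]
    lia

end Step

end Algebra

/-! ### Local constancy of the Fredholm index. -/

section Stability

variable {𝕜 : Type*} [RCLike 𝕜] {X Y : Type*} [NormedAddCommGroup X] [NormedSpace 𝕜 X]
  [CompleteSpace X] [NormedAddCommGroup Y] [NormedSpace 𝕜 Y] [CompleteSpace Y]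

/-- The index of a bounded Fredholm operator is locally constant. -/
theorem FiniteDefect.exists_stable {S : X →L[𝕜] Y} (hS : FiniteDefect (S : X →ₗ[𝕜] Y)) :
    ∃ ε : ℝ, 0 < ε ∧ ∀ S' : X →L[𝕜] Y, ‖S - S'‖ < ε →
      FiniteDefect (S' : X →ₗ[𝕜] Y) ∧
        defectIndex (S' : X →ₗ[𝕜] Y) = defectIndex (S : X →ₗ[𝕜] Y) := by
  have := hS.finite_ker; have := hS.finite_coker
  obtain ⟨P, hP⟩ :=
    Submodule.ClosedComplemented.of_finiteDimensional (LinearMap.ker (S : X →ₗ[𝕜] Y))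
  obtain ⟨C, hC⟩ := Submodule.exists_isCompl (LinearMap.range (S : X →ₗ[𝕜] Y))
  have : FiniteDimensional 𝕜 C :=
    Module.Finite.equiv (Submodule.quotientEquivOfIsCompl _ _ hC)
  have : CompleteSpace C := FiniteDimensional.complete 𝕜 C
  have : CompleteSpace (LinearMap.ker (S : X →ₗ[𝕜] Y)) := FiniteDimensional.complete 𝕜 _
  -- Bordering by a complement of the range and a projection onto the kernel makes S invertible.
  -- Invertibility is an open condition.
  let T : (X →L[𝕜] Y) → (X × C →L[𝕜] Y × LinearMap.ker (S : X →ₗ[𝕜] Y)) := fun S' =>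
    (S'.coprod C.subtypeL).prod (P.comp (ContinuousLinearMap.fst 𝕜 X C))
  have hinj : LinearMap.ker (T S).toLinearMap = ⊥ := by
    rw [LinearMap.ker_eq_bot']
    rintro ⟨x, c⟩ h
    have h₁ : S x + c = 0 := congrArg Prod.fst h
    have h₂ : P x = 0 := congrArg Prod.snd h
    have hSx : S x = 0 := by
      have hm : S x ∈ C := by
        rw [eq_neg_of_add_eq_zero_left h₁]; exact C.neg_mem c.2
      exact Submodule.disjoint_def.1 hC.disjoint _ ⟨x, rfl⟩ hm
    have hx : x = 0 := by
      have := hP ⟨x, hSx⟩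
      rw [h₂] at this
      exact (congrArg Subtype.val this).symm
    have hc : c = 0 := Subtype.ext (by simpa [hSx] using h₁)
    rw [hx, hc]; rfl
  have hsurj : LinearMap.range (T S).toLinearMap = ⊤ := by
    rw [LinearMap.range_eq_top]
    rintro ⟨y, e⟩
    have hy : y ∈ LinearMap.range (S : X →ₗ[𝕜] Y) ⊔ C := by rw [hC.sup_eq_top]; trivial
    obtain ⟨_, ⟨x, rfl⟩, c, hc, rfl⟩ := Submodule.mem_sup.1 hy
    have he : S e = 0 := e.2
    have hPx : S (P x) = 0 := (P x).2
    refine ⟨(x + e - P x, ⟨c, hc⟩), Prod.ext ?_ ?_⟩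
    · simp [T, he, hPx]
    · simp [T, hP]
  have hT : Continuous T := by
    have : T = fun S' => T S + (ContinuousLinearMap.inl 𝕜 Y _).comp
        ((S' - S).comp (ContinuousLinearMap.fst 𝕜 X C)) := by
      ext S' x <;> simp [T]
    rw [this]
    fun_prop
  have hopen := (ContinuousLinearEquiv.isOpen (𝕜 := 𝕜) (E := X × C)
    (F := Y × LinearMap.ker (S : X →ₗ[𝕜] Y))).preimage hT
  obtain ⟨ε, hε, hball⟩ := Metric.isOpen_iff.1 hopen S
    ⟨ContinuousLinearEquiv.ofBijective (T S) hinj hsurj,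
      ContinuousLinearEquiv.coe_ofBijective (T S) hinj hsurj⟩
  have key : ∀ S' : X →L[𝕜] Y, ‖S - S'‖ < ε → FiniteDefect (S' : X →ₗ[𝕜] Y) ∧
      defectIndex (S' : X →ₗ[𝕜] Y) =
        (Module.finrank 𝕜 (LinearMap.ker (S : X →ₗ[𝕜] Y)) : ℤ) - Module.finrank 𝕜 C := by
    intro S' hS'
    obtain ⟨e, he⟩ := hball (show S' ∈ Metric.ball S ε by rwa [mem_ball_iff_norm'])
    refine FiniteDefect.of_bordered_bijective (j := C.subtype) (P := (P : X →ₗ[𝕜] _)) ?_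
    have : Function.Bijective (T S') := by rw [← he]; exact e.bijective
    exact this
  refine ⟨ε, hε, fun S' hS' => ⟨(key S' hS').1, ?_⟩⟩
  rw [(key S' hS').2, (key S (by simpa using hε)).2]

end Stability

/-! ### Recovering a chain from its compressions. -/

section Chain

variable {𝕜 : Type*} [RCLike 𝕜] {H : ℕ → Type*} [∀ p, NormedAddCommGroup (H p)]
  [∀ p, InnerProductSpace 𝕜 (H p)]

/-- If `δ_p δ_{p+1}` has finite rank for all `p`, then the quotients
`R(δ_{p+1}) / (N(δ_p) ∩ R(δ_{p+1}))` are finite dimensional. -/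
theorem finiteDimensional_rangeQuot (δ : ∀ p, H (p + 1) →L[𝕜] H p)
    (h : ∀ p, FiniteDimensional 𝕜
      (LinearMap.range ((δ p).comp (δ (p + 1)) : H (p + 1 + 1) →ₗ[𝕜] H p))) :
    ∀ p, FiniteDimensional 𝕜 (RangeQuot δ p)
  | 0 => by
    have : Subsingleton (RangeQuot δ 0) := by
      refine Submodule.Quotient.subsingleton_iff.2 ?_
      simp [nullSpace, Submodule.submoduleOf]
    infer_instance
  | p + 1 => by
    let f : rangeSpace δ (p + 1) →ₗ[𝕜] H p :=
      (δ p : H (p + 1) →ₗ[𝕜] H p).domRestrict (rangeSpace δ (p + 1))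
    have hr : LinearMap.range f =
        LinearMap.range ((δ p).comp (δ (p + 1)) : H (p + 1 + 1) →ₗ[𝕜] H p) := by
      rw [LinearMap.range_domRestrict, rangeSpace]
      exact (LinearMap.range_comp _ _).symm
    have hk : LinearMap.ker f =
        (nullSpace δ (p + 1) ⊓ rangeSpace δ (p + 1)).submoduleOf (rangeSpace δ (p + 1)) := by
      ext x
      simp [f, Submodule.submoduleOf, nullSpace]
    have : FiniteDimensional 𝕜 (LinearMap.range f) := by rw [hr]; exact h p
    exact Module.Finite.equiv
      (f.quotKerEquivRange.symm.trans (Submodule.quotEquivOfEq _ _ hk))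

/-- The compression of `δ_{p+1}` to a map from the kernel of `π_{p+1}` to the range of `π_p`. -/
abbrev compression {B : ∀ p, Submodule 𝕜 (H p)} (π : ∀ p, H p →ₗ[𝕜] B p)
    (δ : ∀ p, H (p + 1) →L[𝕜] H p) (p : ℕ) : LinearMap.ker (π (p + 1)) →ₗ[𝕜] B p :=
  π p ∘ₗ (δ p : H (p + 1) →ₗ[𝕜] H p) ∘ₗ (LinearMap.ker (π (p + 1))).subtype

/-- The cokernel is controlled by the compression at p, the kernel by the one at p - 1, which kills
N(δ_p) ∩ ker π_p. -/
theorem FiniteDefect.domRestrict_nullSpace {n : ℕ} {δ : ∀ p, H (p + 1) →L[𝕜] H p}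
    {B : ∀ p, Submodule 𝕜 (H p)} {π : ∀ p, H p →ₗ[𝕜] B p}
    (hsub : ∀ p, n < p → Subsingleton (H p))
    (hR : ∀ p, FiniteDimensional 𝕜 (RangeQuot δ p)) (hπ₀ : Function.Bijective (π 0))
    (hs : ∀ p ≤ n, FiniteDefect (compression π δ p)) (p : ℕ) :
    FiniteDefect ((π p).domRestrict (nullSpace δ p)) := by
  rcases lt_or_ge n p with hp | hp
  · have := hsub p hp
    exact ⟨inferInstance, inferInstance⟩
  · refine ⟨?_, finiteDimensional_coker_of_compression (hs p hp) (hR p)⟩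
    cases p with
    | zero =>
      have : LinearMap.ker ((π 0).domRestrict (nullSpace δ 0)) = ⊥ :=
        LinearMap.ker_eq_bot.2 (hπ₀.1.comp Subtype.val_injective)
      rw [this]; infer_instance
    | succ p =>
      have hk := finiteDimensional_ker_of_compression (hs p (by lia))
      have e := kerDomRestrictKerSwap (δ p : H (p + 1) →ₗ[𝕜] H p).rangeRestrict (π (p + 1))
      have := Module.Finite.equiv e
      have hN : nullSpace δ (p + 1) =
        LinearMap.ker (δ p : H (p + 1) →ₗ[𝕜] H p).rangeRestrict :=
        (LinearMap.ker_rangeRestrict _).symm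
      rw [hN]
      exact this

/-- The index of a chain in terms of the indices of its compressions. -/
theorem isFredholmChain_and_index_eq {n : ℕ} {δ : ∀ p, H (p + 1) →L[𝕜] H p}
    {B : ∀ p, Submodule 𝕜 (H p)} {π : ∀ p, H p →ₗ[𝕜] B p}
    (hsub : ∀ p, n < p → Subsingleton (H p))
    (hR : ∀ p, FiniteDimensional 𝕜 (RangeQuot δ p)) (hπ₀ : Function.Bijective (π 0))
    (hπ : ∀ p, Function.Surjective (π p))
    (hs : ∀ p ≤ n, FiniteDefect (compression π δ p)) :
    IsFredholmChain n δ ∧ index n δ =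
      - ∑ p ∈ Finset.range (n + 1), (-1 : ℤ) ^ p * defectIndex (compression π δ p) := by
  have hN := FiniteDefect.domRestrict_nullSpace hsub hR hπ₀ hs
  have hker : ∀ p, nullSpace δ (p + 1) =
      LinearMap.ker (δ p : H (p + 1) →ₗ[𝕜] H p).rangeRestrict :=
    fun p => (LinearMap.ker_rangeRestrict _).symm
  let i : ℕ → ℤ := fun p => defectIndex ((π p).domRestrict (nullSpace δ p))
  have hstep : ∀ p ≤ n, FiniteDimensional 𝕜 (NullQuot δ p) ∧
      (Module.finrank 𝕜 (NullQuot δ p) : ℤ) - Module.finrank 𝕜 (RangeQuot δ p) =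
        i p + i (p + 1) - defectIndex (compression π δ p) := by
    intro p hp
    have h₁ := hN (p + 1)
    -- The exchange of π and δ makes consecutive degrees share i (p + 1).
    have h₂ : i (p + 1) = defectIndex ((δ p : H (p + 1) →ₗ[𝕜] H p).rangeRestrict.domRestrict
        (LinearMap.ker (π (p + 1)))) := by
      simp only [i]
      rw [hker]
      exact defectIndex_domRestrict_ker_swap (hπ _) (LinearMap.surjective_rangeRestrict _)
    rw [hker] at h₁
    rw [h₂]
    exact finiteDimensional_and_index_of_compression (hs p hp) (hR p) (hN p)
      (h₁.domRestrict_ker_swap (hπ _) (LinearMap.surjective_rangeRestrict _))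
  refine ⟨⟨hsub, fun p hp => (hstep p hp).1, fun p _ => hR p⟩, ?_⟩
  have htel : ∀ m, ∑ p ∈ Finset.range m, (-1 : ℤ) ^ p * (i p + i (p + 1)) =
      i 0 - (-1) ^ m * i m := by
    intro m
    induction m with
    | zero => simp
    | succ m ih => rw [Finset.sum_range_succ, ih]; ring
  have hi₀ : i 0 = 0 :=
    defectIndex_of_bijective (f := (π 0).domRestrict (nullSpace δ 0))
      ⟨hπ₀.1.comp Subtype.val_injective, fun y => by
        obtain ⟨x, rfl⟩ := hπ₀.2 y
        exact ⟨⟨x, trivial⟩, rfl⟩⟩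
  have hiₙ : i (n + 1) = 0 := by
    have := hsub (n + 1) (Nat.lt_succ_self n)
    exact defectIndex_of_bijective (f := (π (n + 1)).domRestrict (nullSpace δ (n + 1)))
      ⟨fun _ _ _ => Subsingleton.elim _ _, fun y => ⟨0, Subsingleton.elim _ _⟩⟩
  have hsum : index n δ = ∑ p ∈ Finset.range (n + 1),
      ((-1 : ℤ) ^ p * (i p + i (p + 1)) - (-1 : ℤ) ^ p * defectIndex (compression π δ p)) := by
    refine Finset.sum_congr rfl fun p hp => ?_
    rw [(hstep p (Nat.lt_succ_iff.1 (Finset.mem_range.1 hp))).2]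
    ring
  rw [hsum, Finset.sum_sub_distrib, htel, hi₀, hiₙ]
  ring

theorem isClosed_nullSpace (δ : ∀ p, H (p + 1) →L[𝕜] H p) :
    ∀ p, IsClosed (nullSpace δ p : Set (H p))
  | 0 => isClosed_univ
  | p + 1 => (δ p).isClosed_ker

end Chain

end HilbertChain

/-! ### The stability theorem. -/

open HilbertChain in
theorem theorem6p5 {𝕜 : Type*} [RCLike 𝕜] (n : ℕ) (H : ℕ → Type*)
    [∀ p, NormedAddCommGroup (H p)] [∀ p, InnerProductSpace 𝕜 (H p)] [∀ p, CompleteSpace (H p)]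
    (δ : ∀ p, H (p + 1) →L[𝕜] H p) (hδ : HilbertChain.IsFredholmChain n δ) :
    ∃ ε : ℝ, 0 < ε ∧ ∀ δ' : ∀ p, H (p + 1) →L[𝕜] H p,
      (∀ p, FiniteDimensional 𝕜
        (LinearMap.range ((δ' p).comp (δ' (p + 1)) : H (p + 1 + 1) →ₗ[𝕜] H p))) →
      (∀ p, ‖δ p - δ' p‖ < ε) →
      HilbertChain.IsFredholmChain n δ' ∧
        HilbertChain.index n δ = HilbertChain.index n δ' := by
  have hcomp : ∀ p, CompleteSpace (nullSpace δ p) := fun p =>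
    (isClosed_nullSpace δ p).completeSpace_coe
  let π : ∀ p, H p →L[𝕜] nullSpace δ p := fun p => (nullSpace δ p).orthogonalProjectionOnto
  let πl : ∀ p, H p →ₗ[𝕜] nullSpace δ p := fun p => (π p).toLinearMap
  have hid : ∀ p (x : nullSpace δ p), π p x = x := fun p x =>
    (nullSpace δ p).orthogonalProjectionOnto_mem_subspace_eq_self x
  have hπ : ∀ p, Function.Surjective (πl p) := fun p x => ⟨x, hid p x⟩
  have hπN : ∀ p, Function.Bijective ((πl p).domRestrict (nullSpace δ p)) := by
    intro p
    have : ((πl p).domRestrict (nullSpace δ p)) = LinearMap.id := LinearMap.ext (hid p)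
    rw [this]
    exact Function.bijective_id
  have hπ₀ : Function.Bijective (πl 0) := by
    refine ⟨fun x y h => ?_, hπ 0⟩
    have := (hπN 0).1 (a₁ := ⟨x, trivial⟩) (a₂ := ⟨y, trivial⟩) h
    exact congrArg Subtype.val this
  have hR : ∀ p, FiniteDimensional 𝕜 (RangeQuot δ p) := by
    intro p
    rcases lt_or_ge n p with hp | hp
    · have := hδ.subsingleton p hp
      infer_instance
    · exact hδ.finite_rangeQuot p hp
  have hs : ∀ p ≤ n, FiniteDefect (compression πl δ p) := by
    intro p hp
    refine FiniteDefect.comp_subtype (hδ.finite_nullQuot p hp) (hR p) (.of_bijective (hπN p)) ?_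
    refine FiniteDefect.domRestrict_ker_swap (hπ (p + 1)) (LinearMap.surjective_rangeRestrict _) ?_
    have hker : LinearMap.ker (δ p : H (p + 1) →ₗ[𝕜] H p).rangeRestrict = nullSpace δ (p + 1) :=
      LinearMap.ker_rangeRestrict _
    rw [hker]
    exact .of_bijective (hπN (p + 1))
  have hK : ∀ p, CompleteSpace (LinearMap.ker (πl p)) := fun p =>
    (π p).isClosed_ker.completeSpace_coe
  let S : (∀ p, H (p + 1) →L[𝕜] H p) → ∀ p, LinearMap.ker (πl (p + 1)) →L[𝕜] nullSpace δ p :=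
    fun δ' p => (π p).comp ((δ' p).comp (LinearMap.ker (πl (p + 1))).subtypeL)
  have hstab : ∀ p, ∃ ε : ℝ, 0 < ε ∧ (p ≤ n → ∀ δ' : ∀ p, H (p + 1) →L[𝕜] H p,
      ‖δ p - δ' p‖ < ε → FiniteDefect (compression πl δ' p) ∧
        defectIndex (compression πl δ' p) = defectIndex (compression πl δ p)) := by
    intro p
    by_cases hp : p ≤ n
    · obtain ⟨ε, hε, h⟩ := FiniteDefect.exists_stable (S := S δ p) (hs p hp)
      refine ⟨ε, hε, fun _ δ' hδ' => h (S δ' p) (lt_of_le_of_lt ?_ hδ')⟩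
      -- Orthogonal projections are contractions, so compressing does not increase the distance.
      refine ContinuousLinearMap.opNorm_le_bound _ (norm_nonneg _) fun x => ?_
      have : (S δ p - S δ' p) x = π p ((δ p - δ' p) x) := by simp [S]
      rw [this]
      exact ((nullSpace δ p).norm_orthogonalProjectionOnto_apply_le _).trans
        ((δ p - δ' p).le_opNorm x)
    · exact ⟨1, one_pos, fun h => absurd h hp⟩
  choose ε hε hstab using hstab
  -- Only the finitely many degrees p ≤ n constrain ε.
  refine ⟨(Finset.range (n + 1)).inf' Finset.nonempty_range_add_one ε,
    (Finset.lt_inf'_iff _).2 fun p _ => hε p, fun δ' hfin hnorm => ?_⟩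
  have hs' : ∀ p ≤ n, FiniteDefect (compression πl δ' p) ∧
      defectIndex (compression πl δ' p) = defectIndex (compression πl δ p) := fun p hp =>
    hstab p hp δ' ((hnorm p).trans_le
      (Finset.inf'_le _ (Finset.mem_range.2 (Nat.lt_succ_of_le hp))))
  obtain ⟨hF, hI⟩ := isFredholmChain_and_index_eq hδ.subsingleton
    (finiteDimensional_rangeQuot δ' hfin) hπ₀ hπ fun p hp => (hs' p hp).1
  refine ⟨hF, ?_⟩
  rw [hI, (isFredholmChain_and_index_eq hδ.subsingleton hR hπ₀ hπ hs).2]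
  congr 1
  refine Finset.sum_congr rfl fun p hp => ?_
  rw [(hs' p (Nat.lt_succ_iff.1 (Finset.mem_range.1 hp))).2]
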